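/- Let $R_\infty$ be the symmetric inverse semigroup: the monoid, under matrix multiplication, of all infinite 0-1 matrices $r=[r_{ij}]_{i,j\in\mathbb{N}}$ with at most one $1$ in each row and each column and with $r_{nn}=1$ for all but finitely many $n$, with the involution $r^\star=[r_{ji}]$ and unit $e$. A finite (indecomposable) character of $R_\infty$ is a function $f:R_\infty\to\mathbb{C}$ such that (1) $f(rs)=f(sr)$ for all $r,s\in R_\infty$; (2) for all $r_1,\dots,r_n\in R_\infty$ the matrix $[f(r_i^\star r_j)]$ is Hermitian and nonnegative definite; (3) $f$ is not a sum of two linearly independent functions satisfying (1) and (2); (4) $f(e)=1$. The support of $r\in R_\infty$ is ${\rm supp}\,r=\{n\in\mathbb{N}: r_{nn}\neq 1\}$. A quasicycle is an element $q=c\cdot\epsilon_{A}$, where $c$ is the permutation matrix of a cycle $(n_1\;n_2\;\cdots\;n_m)$ with $m\ge 1$ and $n_1,\dots,n_m$ distinct, $A\subseteq\{n_1,\dots,n_m\}$, and $\epsilon_A$ is the diagonal matrix with entries $0$ at the places in $A$ and $1$ elsewhere. Theorem (Multiplicativity). Let $f$ be a finite character of $R_\infty$ and let $r=q_1q_2\cdots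 q_k$ be a product of quasicycles with pairwise disjoint supports. Then $f(r)=\prod_{j=1}^k f(q_j)$. -/

import Mathlib

open scoped ComplexOrder

/-- The symmetric inverse semigroup `R_∞`: partial injections `r` of `ℕ` with `r n = n` for all but
finitely many `n`. The partial injection `r` stands for the 0-1 matrix whose `(i, j)` entry is `1`
exactly when `r i = j`; see `RInfty.matrix` and the lemmas about it below. -/
@[ext]
structure RInfty where
  toPEquiv : ℕ ≃. ℕ
  finite_supp : {n | toPEquiv n ≠ some n}.Finite

namespace RInfty

/-- The support of `r`: the complement of the set of `n` with `r_{nn} = 1`. -/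
def supp (r : RInfty) : Set ℕ := {n | r.toPEquiv n ≠ some n}

/-- Matrix product: `(r * s)_{ij} = ∑ k, r_{ik} s_{kj}`, that is, first `r`, then `s`. -/
instance : Mul RInfty where
  mul r s := ⟨r.toPEquiv.trans s.toPEquiv, by
    refine (r.finite_supp.union s.finite_supp).subset fun n hn => ?_
    by_contra h
    simp only [Set.mem_union, Set.mem_ofPred_eq, not_or, not_not] at h
    exact hn ((PEquiv.trans_eq_some _ _ _ _).2 ⟨n, h.1, h.2⟩)⟩

instance : One RInfty where
  one := ⟨PEquiv.refl ℕ, by simp⟩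

/-- Matrix transposition. -/
instance : Star RInfty where
  star r := ⟨r.toPEquiv.symm, by
    refine r.finite_supp.subset fun n hn h => hn ?_
    exact (PEquiv.eq_some_iff r.toPEquiv).2 h⟩

@[simp] theorem mul_toPEquiv (r s : RInfty) :
    (r * s).toPEquiv = r.toPEquiv.trans s.toPEquiv := rfl

@[simp] theorem one_toPEquiv : (1 : RInfty).toPEquiv = PEquiv.refl ℕ := rfl

@[simp] theorem star_toPEquiv (r : RInfty) : (star r).toPEquiv = r.toPEquiv.symm := rfl

instance : Monoid RInfty where
  mul_assoc r s t := RInfty.ext (PEquiv.trans_assoc _ _ _)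
  one_mul r := RInfty.ext (PEquiv.refl_trans _)
  mul_one r := RInfty.ext (PEquiv.trans_refl _)

instance : StarMul RInfty where
  star_involutive _ := RInfty.ext (PEquiv.symm_symm _)
  star_mul _ _ := RInfty.ext (PEquiv.symm_trans_rev _ _)

/-- The infinite 0-1 matrix of an element of `R_∞`. -/
def matrix (r : RInfty) : Matrix ℕ ℕ ℕ :=
  Matrix.of fun i j => if r.toPEquiv i = some j then 1 else 0

theorem matrix_eq_one_iff (r : RInfty) (i j : ℕ) :
    r.matrix i j = 1 ↔ r.toPEquiv i = some j := by
  simp [matrix]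

theorem supp_eq (r : RInfty) : r.supp = {n | r.matrix n n = 1}ᶜ := by
  ext n
  simp [supp, matrix_eq_one_iff]

/-- Multiplication in `R_∞` is ordinary matrix multiplication. -/
theorem matrix_mul (r s : RInfty) (i j : ℕ) :
    (r * s).matrix i j = ∑ᶠ k, r.matrix i k * s.matrix k j := by
  cases h : r.toPEquiv i with
  | none => simp [matrix, PEquiv.trans, h]
  | some m =>
    rw [finsum_eq_single _ m]
    · simp [matrix, PEquiv.trans, h]
    · intro k hk
      simp [matrix, h, hk.symm]

theorem matrix_star (r : RInfty) : (star r).matrix = r.matrix.transpose := by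
  ext i j
  simp [matrix, PEquiv.eq_some_iff]

/-- `R_∞` is in bijection, via `RInfty.matrix`, with the 0-1 matrices that have at most one `1` in
each row and in each column and whose diagonal entries are `1` off a finite set. -/
theorem existsUnique_matrix_eq (g : Matrix ℕ ℕ ℕ) (h01 : ∀ i j, g i j = 0 ∨ g i j = 1)
    (hrow : ∀ i j j', g i j = 1 → g i j' = 1 → j = j')
    (hcol : ∀ i i' j, g i j = 1 → g i' j = 1 → i = i')
    (hfin : {n | g n n ≠ 1}.Finite) : ∃! r : RInfty, r.matrix = g := by
  classical
  let F : ℕ → Option ℕ := fun i => if h : ∃ j, g i j = 1 then some h.choose else none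
  let G : ℕ → Option ℕ := fun j => if h : ∃ i, g i j = 1 then some h.choose else none
  have hF : ∀ i j, F i = some j ↔ g i j = 1 := by
    intro i j
    by_cases h : ∃ j, g i j = 1
    · simp only [F, dif_pos h, Option.some.injEq]
      exact ⟨fun e => e ▸ h.choose_spec, fun e => hrow i _ _ h.choose_spec e⟩
    · simp only [F, dif_neg h]
      simpa using fun e => h ⟨j, e⟩
  have hG : ∀ i j, G j = some i ↔ g i j = 1 := by
    intro i j
    by_cases h : ∃ i, g i j = 1
    · simp only [G, dif_pos h, Option.some.injEq]
      exact ⟨fun e => e ▸ h.choose_spec, fun e => hcol _ _ j h.choose_spec e⟩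
    · simp only [G, dif_neg h]
      simpa using fun e => h ⟨i, e⟩
  let P : ℕ ≃. ℕ := ⟨F, G, fun i j => by
    exact (hG i j).trans (hF i j).symm⟩
  have hP : ∀ i j, P i = some j ↔ g i j = 1 := hF
  refine ⟨⟨P, by simpa only [ne_eq, hP] using hfin⟩, ?_, ?_⟩
  · ext i j
    rcases h01 i j with h | h <;> simp [matrix, hP, h]
  · rintro s rfl
    refine RInfty.ext (PEquiv.ext fun i => Option.ext fun j => ?_)
    exact ((hP i j).trans (matrix_eq_one_iff s i j)).symm

/-- A finitely supported permutation of `ℕ`, as an element of `𝔖_∞ ⊂ R_∞`. -/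
def ofPerm (σ : Equiv.Perm ℕ) (hσ : {n | σ n ≠ n}.Finite) : RInfty :=
  ⟨σ.toPEquiv, by simpa [Equiv.toPEquiv_apply] using hσ⟩

/-- The cycle `(n₁ n₂ … n_k)`, for a list `l = [n₁, …, n_k]` of distinct naturals. -/
def cycle (l : List ℕ) : RInfty :=
  ofPerm l.formPerm (l.toFinset.finite_toSet.subset fun n hn => by
    by_contra h
    exact hn (List.formPerm_apply_of_notMem (by simpa using h)))

/-- The diagonal matrix `ε_A` with `0` at the places in `A` and `1` at all other places. -/
def epsilon (A : Finset ℕ) : RInfty :=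
  ⟨PEquiv.ofSet {n | n ∉ A}, A.finite_toSet.subset fun n hn => by
    by_contra h
    exact hn (PEquiv.ofSet_eq_some_self_iff.2 (by simpa using h))⟩

/-- A quasicycle: `c * ε_A` with `c = (n₁ … n_k)`, `k ≥ 1`, a cycle and `A ⊆ {n₁, …, n_k}`.
For `k = 1` these are the identity and the elements `ε_{{n}}`. -/
def IsQuasicycle (q : RInfty) : Prop :=
  ∃ l : List ℕ, l ≠ [] ∧ l.Nodup ∧ ∃ A : Finset ℕ, A ⊆ l.toFinset ∧ q = cycle l * epsilon A

/-- `f (r s) = f (s r)` for all `r, s`. -/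
def IsCentral (f : RInfty → ℂ) : Prop :=
  ∀ r s, f (r * s) = f (s * r)

/-- For all `r₁, …, r_n` the matrix `[f (r_i^⋆ r_j)]` is Hermitian and nonnegative definite. -/
def IsPositiveDefinite (f : RInfty → ℂ) : Prop :=
  ∀ (n : ℕ) (r : Fin n → RInfty), (Matrix.of fun i j => f (star (r i) * r j)).PosSemidef

/-- `f` is not a sum of two linearly independent central positive definite functions. -/
def IsIndecomposable (f : RInfty → ℂ) : Prop :=
  ¬ ∃ g h : RInfty → ℂ, IsCentral g ∧ IsPositiveDefinite g ∧ IsCentral h ∧ IsPositiveDefinite h ∧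
    LinearIndependent ℂ ![g, h] ∧ f = g + h

/-- Finite characters of `R_∞`: central, positive definite, indecomposable, normalized. -/
structure IsFiniteCharacter (f : RInfty → ℂ) : Prop where
  central : IsCentral f
  positiveDefinite : IsPositiveDefinite f
  indecomposable : IsIndecomposable f
  map_one : f 1 = 1

end RInfty

namespace RInfty

open Filter Topology Matrix

/-! Everything reduces to f(rs) = f(r)f(s) for r, s with disjoint supports. Conjugating s by
permutations that commute with r pushes its support to infinity: this gives t_n with f(t_n) = f(s)
and f(r t_n) = f(rs). Any ultrafilter limit F(x) = lim f(x t_n) is central, because t_n eventually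
commutes with each x. By `translate`, the combinations (2f + zF + z̄F')/4 with |z| = 1, where F'
comes from the t_n^⋆, are positive definite, and those for z and -z add up to f. Indecomposability
makes each a multiple of f, hence F = c f. Evaluating at 1 gives c = f(s), and at r gives f(rs) =
f(s)f(r). -/

theorem notMem_supp {r : RInfty} {n : ℕ} : n ∉ r.supp ↔ r.toPEquiv n = some n := by
  simp [supp]

theorem supp_one : (1 : RInfty).supp = ∅ := by
  ext n
  simp [supp]

theorem supp_star (r : RInfty) : (star r).supp = r.supp := by
  ext n
  exact not_congr (PEquiv.eq_some_iff r.toPEquiv)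

theorem supp_mul_subset (r s : RInfty) : (r * s).supp ⊆ r.supp ∪ s.supp := by
  intro n hn
  by_contra h
  simp only [Set.mem_union, not_or, notMem_supp] at h
  exact hn ((PEquiv.trans_eq_some _ _ _ _).2 ⟨n, h.1, h.2⟩)

theorem mul_apply (r s : RInfty) (n : ℕ) :
    (r * s).toPEquiv n = (r.toPEquiv n).bind s.toPEquiv := rfl

theorem mul_apply_of_disjoint {r s : RInfty} (h : Disjoint r.supp s.supp) {n : ℕ}
    (hn : n ∉ s.supp) :
    (r * s).toPEquiv n = r.toPEquiv n ∧ (s * r).toPEquiv n = r.toPEquiv n := by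
  refine ⟨?_, by rw [mul_apply, notMem_supp.1 hn, Option.bind_some]⟩
  rw [mul_apply]
  cases hr : r.toPEquiv n with
  | none => rfl
  | some m =>
    refine notMem_supp.1 fun hm => ?_
    have hrm := notMem_supp.1 (Set.disjoint_right.1 h hm)
    exact hn (r.toPEquiv.inj hr hrm ▸ hm)

/-- Elements with disjoint supports commute. -/
theorem mul_comm_of_disjoint {r s : RInfty} (h : Disjoint r.supp s.supp) : r * s = s * r := by
  refine RInfty.ext (PEquiv.ext fun n => ?_)
  by_cases hn : n ∈ s.supp
  · have h' := mul_apply_of_disjoint h.symm (Set.disjoint_right.1 h hn)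
    rw [h'.1, h'.2]
  · have h' := mul_apply_of_disjoint h hn
    rw [h'.1, h'.2]

theorem supp_list_prod_subset {A : Set ℕ} (l : List RInfty) (h : ∀ r ∈ l, r.supp ⊆ A) :
    l.prod.supp ⊆ A := by
  induction l with
  | nil => simp [supp_one]
  | cons r l ih =>
    rw [List.prod_cons]
    exact (supp_mul_subset _ _).trans (Set.union_subset (h r (by simp))
      (ih fun s hs => h s (by simp [hs])))

theorem mul_star_mul_self (r : RInfty) : r * star r * r = r := by
  refine RInfty.ext (PEquiv.ext fun n => ?_)
  cases h : r.toPEquiv n with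
  | none => rw [mul_apply, mul_apply, h, Option.bind_none, Option.bind_none]
  | some m =>
    have h' : (star r).toPEquiv m = some n := (PEquiv.eq_some_iff r.toPEquiv).2 h
    rw [mul_apply, mul_apply, h, Option.bind_some, h', Option.bind_some, h]

/-! ### Pushing a support to infinity by conjugation -/

/-- A finitely supported involution exchanging a finite set of small numbers with a translate. -/
def shiftFun (S : Finset ℕ) (M n : ℕ) : ℕ :=
  if n ∈ S then n + M else if M ≤ n ∧ n - M ∈ S then n - M else n

theorem shiftFun_involutive {S : Finset ℕ} {M : ℕ} (h : ∀ n ∈ S, n < M) :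
    Function.Involutive (shiftFun S M) := by
  intro n
  by_cases h1 : n ∈ S
  · have h2 : n + M ∉ S := fun hn => by have := h _ hn; omega
    simp [shiftFun, h1, h2]
  · by_cases h2 : M ≤ n ∧ n - M ∈ S
    · simp [shiftFun, h1, h2]
    · have h3 : shiftFun S M n = n := by simp only [shiftFun, if_neg h1, if_neg h2]
      rw [h3, h3]

theorem mem_of_shiftFun_ne {S : Finset ℕ} {M n : ℕ} (h : shiftFun S M n ≠ n) :
    n ∈ S ∨ M ≤ n := by
  by_contra! h'
  refine h ?_
  rw [shiftFun, if_neg h'.1, if_neg fun h2 => absurd h2.1 (not_le.2 h'.2)]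

/-- Swap the support of s with a translate of it lying beyond N and beyond both supports; this swap
does not touch the support of r, so it commutes with r. -/
theorem exists_conj_supp {r s : RInfty} (h : Disjoint r.supp s.supp) (N : ℕ) :
    ∃ u : RInfty, star u * u = 1 ∧ r * u = u * r ∧ ∀ n ∈ (u * s * star u).supp, N ≤ n := by
  classical
  obtain ⟨B, hB⟩ := (r.finite_supp.union s.finite_supp).bddAbove
  let S : Finset ℕ := s.finite_supp.toFinset
  have hS : ∀ n, n ∈ S ↔ n ∈ s.supp := fun n => by simp [S, supp]
  let M := N + B + 1
  have hlt : ∀ n ∈ S, n < M := fun n hn => by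
    have := hB (Set.mem_union_right _ ((hS n).1 hn))
    omega
  let e : Equiv.Perm ℕ := (shiftFun_involutive hlt).toPerm
  have he : ∀ n, e n = shiftFun S M n := fun n => rfl
  have hfin : {n | e n ≠ n}.Finite := by
    refine ((S.finite_toSet).union (S.image (· + M)).finite_toSet).subset fun n hn => ?_
    by_contra hn'
    simp only [Set.mem_union, Finset.mem_coe, Finset.mem_image, not_or, not_exists,
      not_and] at hn'
    refine hn ?_
    rw [he, shiftFun, if_neg hn'.1, if_neg fun h2 => hn'.2 _ h2.2 (Nat.sub_add_cancel h2.1)]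
  let u := ofPerm e hfin
  have hu : ∀ n, u.toPEquiv n = some (shiftFun S M n) := fun n => Equiv.toPEquiv_apply e n
  have hu' : ∀ n, (star u).toPEquiv n = some (shiftFun S M n) := fun n =>
    (PEquiv.eq_some_iff u.toPEquiv).2 (by rw [hu, shiftFun_involutive hlt])
  refine ⟨u, ?_, mul_comm_of_disjoint (Set.disjoint_left.2 fun n hr hn => ?_), ?_⟩
  · refine RInfty.ext (PEquiv.ext fun n => ?_)
    rw [mul_apply, hu', Option.bind_some, hu, shiftFun_involutive hlt]
    rfl
  · have hne : shiftFun S M n ≠ n := fun hne => hn (by rw [hu, hne])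
    rcases mem_of_shiftFun_ne hne with h1 | h1
    · exact Set.disjoint_left.1 h hr ((hS n).1 h1)
    · have := hB (Set.mem_union_left _ hr)
      omega
  · intro n hn
    by_contra! hnN
    refine hn ?_
    -- The involution carries S beyond M > N, so no point below N lands in S, and the conjugate
    -- fixes it.
    have hfix : shiftFun S M n ∉ S := by
      by_cases h1 : n ∈ S
      · intro h2
        have := hlt _ h2
        rw [shiftFun, if_pos h1] at this
        omega
      · by_contra h2
        by_cases h3 : shiftFun S M n = n
        · exact h1 (h3 ▸ h2)
        · rcases mem_of_shiftFun_ne h3 with h4 | h4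
          · exact h1 h4
          · omega
    have hs := notMem_supp.1 fun h2 => hfix ((hS _).2 h2)
    rw [mul_apply, mul_apply, hu, Option.bind_some, hs, Option.bind_some, hu',
      shiftFun_involutive hlt]

/-! ### Positive definite functions -/

section PositiveDefinite

variable {f g : RInfty → ℂ}

theorem IsPositiveDefinite.posSemidef (hf : IsPositiveDefinite f) {ι : Type*} [Fintype ι]
    (r : ι → RInfty) : (Matrix.of fun i j => f (star (r i) * r j)).PosSemidef := by
  let e := (Fintype.equivFin ι).symm
  refine (Matrix.posSemidef_submatrix_equiv e).1 ?_
  exact hf _ (r ∘ e)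

theorem IsPositiveDefinite.add (hf : IsPositiveDefinite f) (hg : IsPositiveDefinite g) :
    IsPositiveDefinite (f + g) := fun n r => (hf n r).add (hg n r)

theorem IsPositiveDefinite.smul (hf : IsPositiveDefinite f) {a : ℂ} (ha : 0 ≤ a) :
    IsPositiveDefinite (a • f) := fun n r => (hf n r).smul ha

theorem IsPositiveDefinite.map_one_nonneg (hf : IsPositiveDefinite f) : 0 ≤ f 1 := by
  simpa using (hf 1 fun _ => 1).diag_nonneg (i := 0)

theorem IsPositiveDefinite.map_star (hf : IsPositiveDefinite f) (x : RInfty) :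
    f (star x) = star (f x) := by
  have := (hf 2 ![1, x]).isHermitian.apply 1 0
  simpa using this.symm

theorem IsPositiveDefinite.of_tendsto {α : Type*} {l : Filter α} [l.NeBot]
    {F : α → RInfty → ℂ} (hF : ∀ a, IsPositiveDefinite (F a))
    (h : ∀ x, Tendsto (fun a => F a x) l (𝓝 (f x))) : IsPositiveDefinite f := by
  intro n r
  refine PosSemidef.of_dotProduct_mulVec_nonneg ?_ fun x => ?_
  · refine Matrix.IsHermitian.ext fun i j => ?_
    refine tendsto_nhds_unique ((h _).star) ((h _).congr fun a => ?_)
    exact ((hF a n r).isHermitian.apply i j).symm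
  · have hlim : Tendsto (fun a => star x ⬝ᵥ ((Matrix.of fun i j => F a (star (r i) * r j)) *ᵥ x)) l
        (𝓝 (star x ⬝ᵥ ((Matrix.of fun i j => f (star (r i) * r j)) *ᵥ x))) := by
      simp only [dotProduct, mulVec]
      exact tendsto_finsetSum _ fun i _ => Tendsto.const_mul _
        (tendsto_finsetSum _ fun j _ => (h _).mul_const _)
    exact ge_of_tendsto' hlim fun a => (hF a n r).dotProduct_mulVec_nonneg x

/-- The positive definite function `r ↦ f ((1 + z t)^⋆ r (1 + z t))`. -/
theorem IsPositiveDefinite.compression (hf : IsPositiveDefinite f) (t : RInfty) (z : ℂ) :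
    IsPositiveDefinite fun r => f r + z * f (r * t) + star z * f (star t * r)
      + star z * z * f (star t * r * t) := by
  intro n r
  -- The matrix is the Gram matrix of the r_i + z r_i t, obtained from that of the doubled family
  -- (r_i, r_i t).
  let B : Matrix (Fin n ⊕ Fin n) (Fin n) ℂ := fromRows 1 (z • 1)
  have key := (hf.posSemidef (Sum.elim r fun i => r i * t)).conjTranspose_mul_mul_same B
  have hblock : (Matrix.of fun i j => f (star (Sum.elim r (fun i => r i * t) i) *
      Sum.elim r (fun i => r i * t) j)) = fromBlocks
        (Matrix.of fun i j => f (star (r i) * r j))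
        (Matrix.of fun i j => f (star (r i) * r j * t))
        (Matrix.of fun i j => f (star t * (star (r i) * r j)))
        (Matrix.of fun i j => f (star t * (star (r i) * r j) * t)) := by
    ext (i | i) (j | j) <;> simp [mul_assoc]
  rw [hblock, conjTranspose_fromRows_eq_fromCols_conjTranspose, Matrix.mul_assoc,
    fromBlocks_mul_fromRows, fromCols_mul_fromRows] at key
  convert key using 1
  ext i j
  simp
  ring

/-- For `|z| = 1` and a contraction `t`, the element `2 + z t + (z t)^⋆` is positive. -/
theorem IsPositiveDefinite.translate (hf : IsPositiveDefinite f) (hc : IsCentral f) (t : RInfty)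
    {z : ℂ} (hz : star z * z = 1) :
    IsPositiveDefinite fun r => 2 * f r + z * f (r * t) + star z * f (r * star t) := by
  have hp : t * star t * (t * star t) = t * star t := by
    rw [← mul_assoc, mul_star_mul_self]
  -- With p = t t^⋆ idempotent, the compression by 1 - p contributes f(r) - f(rp), which turns the
  -- term f(t^⋆ r t) = f(rp) into f(r).
  convert (hf.compression t z).add (hf.compression (t * star t) (-1)) using 1
  funext r
  have h1 : f (star t * r) = f (r * star t) := hc _ _
  have h2 : f (star t * r * t) = f (r * (t * star t)) := by
    rw [mul_assoc, hc, mul_assoc]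
  have h3 : f (t * star t * r) = f (r * (t * star t)) := hc _ _
  have h4 : f (t * star t * r * (t * star t)) = f (r * (t * star t)) := by
    rw [mul_assoc, hc, mul_assoc, hp]
  simp only [Pi.add_apply, star_mul, star_star, h1, h2, h3, h4, hz]
  simp
  ring

theorem IsPositiveDefinite.norm_le_one (hf : IsPositiveDefinite f) (hc : IsCentral f)
    (h1 : f 1 = 1) (t : RInfty) : ‖f t‖ ≤ 1 := by
  rcases eq_or_ne (f t) 0 with h0 | h0
  · simp [h0]
  have hn : (‖f t‖ : ℂ) ≠ 0 := by simpa using h0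
  have hmul : star (f t) * f t = (‖f t‖ : ℂ) ^ 2 := Complex.conj_mul' (f t)
  -- The phase with z f(t) = -|f(t)|: the translated function at 1 is then 2 - 2|f(t)| ≥ 0.
  let z : ℂ := -(star (f t) / ‖f t‖)
  have hsz : star z = -(f t / ‖f t‖) := by simp [z]
  have hz : star z * z = 1 := by
    rw [hsz]
    simp only [z]
    field_simp
    rw [mul_comm, hmul]
  have h := (hf.translate hc t hz).map_one_nonneg
  have hval : 2 * f 1 + z * f (1 * t) + star z * f (1 * star t) = ((2 - 2 * ‖f t‖ : ℝ) : ℂ) := by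
    rw [one_mul, one_mul, hf.map_star, hsz, h1]
    simp only [z]
    push_cast
    field_simp
    linear_combination (-2) * hmul
  rw [hval] at h
  have := Complex.zero_le_real.1 h
  linarith

end PositiveDefinite

/-! ### Consequences of indecomposability -/

/-- A central positive definite function dominated by a finite character is proportional to it. -/
theorem IsFiniteCharacter.eq_smul_of_add_eq {f g h : RInfty → ℂ} (hf : IsFiniteCharacter f)
    (hgc : IsCentral g) (hgp : IsPositiveDefinite g) (hhc : IsCentral h)
    (hhp : IsPositiveDefinite h) (hfgh : f = g + h) : ∃ c : ℂ, g = c • f := by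
  have hdep : ¬ LinearIndependent ℂ ![g, h] := fun hl =>
    hf.indecomposable ⟨g, h, hgc, hgp, hhc, hhp, hl, hfgh⟩
  by_cases hg0 : g = 0
  · exact ⟨0, by simp [hg0]⟩
  rw [LinearIndependent.pair_iff' hg0] at hdep
  push Not at hdep
  obtain ⟨a, ha⟩ := hdep
  have hfa : f = (1 + a) • g := by rw [hfgh, ← ha, add_smul, one_smul]
  have ha0 : 1 + a ≠ 0 := fun h0 => by
    have := hf.map_one
    rw [hfa, h0] at this
    simp at this
  exact ⟨(1 + a)⁻¹, by rw [hfa, inv_smul_smul₀ ha0]⟩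

/-- Multiplicativity of finite characters on elements with disjoint supports. -/
theorem IsFiniteCharacter.map_mul_of_disjoint {f : RInfty → ℂ} (hf : IsFiniteCharacter f)
    {r s : RInfty} (hrs : Disjoint r.supp s.supp) : f (r * s) = f r * f s := by
  choose u hu hru hsupp using exists_conj_supp hrs
  let t : ℕ → RInfty := fun n => u n * s * star (u n)
  have ht : ∀ n, f (t n) = f s := fun n => by
    simp only [t]
    rw [hf.central, ← mul_assoc, hu, one_mul]
  have hrt : ∀ n, f (r * t n) = f (r * s) := fun n => by
    simp only [t]
    rw [← mul_assoc, ← mul_assoc, hru, hf.central, ← mul_assoc, ← mul_assoc, hu, one_mul]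
  have hcomm : ∀ x : RInfty, ∀ᶠ n in (hyperfilter ℕ : Filter ℕ), Disjoint x.supp (t n).supp := by
    intro x
    obtain ⟨B, hB⟩ := x.finite_supp.bddAbove
    filter_upwards [Nat.hyperfilter_le_atTop (eventually_gt_atTop B)] with n hn
    refine Set.disjoint_left.2 fun m hm hm' => ?_
    have h1 := hB hm
    have h2 := hsupp n m hm'
    omega
  -- Since |f| ≤ 1, compactness of the disc gives limits along the ultrafilter for all x at once,
  -- with no diagonal subsequence.
  have hlim : ∀ v : ℕ → RInfty, ∃ c : ℂ,
      Tendsto (fun n => f (v n)) (hyperfilter ℕ : Filter ℕ) (𝓝 c) := by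
    intro v
    obtain ⟨c, -, hc⟩ := (isCompact_closedBall (0 : ℂ) 1).ultrafilter_le_nhds
      ((hyperfilter ℕ).map fun n => f (v n)) (by
        rw [le_principal_iff]
        refine mem_map.2 (univ_mem' fun n => ?_)
        simpa using hf.positiveDefinite.norm_le_one hf.central hf.map_one (v n))
    exact ⟨c, hc⟩
  choose F hF using fun x : RInfty => hlim fun n => x * t n
  choose F' hF' using fun x : RInfty => hlim fun n => x * star (t n)
  have central_of_disjoint : ∀ (G : RInfty → ℂ) (v : ℕ → RInfty),
      (∀ x, Tendsto (fun n => f (x * v n)) (hyperfilter ℕ : Filter ℕ) (𝓝 (G x))) →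
      (∀ x : RInfty, ∀ᶠ n in (hyperfilter ℕ : Filter ℕ), Disjoint x.supp (v n).supp) →
      IsCentral G := by
    intro G v hG hv x y
    refine tendsto_nhds_unique_of_eventuallyEq (hG _) (hG _) ?_
    filter_upwards [hv x] with n hn
    rw [mul_assoc, hf.central, mul_assoc, ← mul_comm_of_disjoint hn, mul_assoc]
  have hFc : IsCentral F := central_of_disjoint F t hF hcomm
  have hFc' : IsCentral F' := central_of_disjoint F' (fun n => star (t n)) hF' fun x => by
    simpa only [supp_star] using hcomm x
  -- The factor 1/4 makes G z + G (-z) = f.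
  let G : ℂ → RInfty → ℂ := fun z x => 4⁻¹ * (2 * f x + z * F x + star z * F' x)
  have hGc : ∀ z, IsCentral (G z) := fun z x y => by
    simp only [G, hf.central x y, hFc x y, hFc' x y]
  have hGp : ∀ z, star z * z = 1 → IsPositiveDefinite (G z) := fun z hz => by
    refine IsPositiveDefinite.smul (a := 4⁻¹)
      (f := fun x => 2 * f x + z * F x + star z * F' x) ?_ (by positivity)
    exact IsPositiveDefinite.of_tendsto
      (fun n => hf.positiveDefinite.translate hf.central (t n) hz)
      fun x => (tendsto_const_nhds.add ((hF x).const_mul z)).add ((hF' x).const_mul (star z))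
  have hG : ∀ z, star z * z = 1 → ∃ c : ℂ, G z = c • f := fun z hz => by
    refine hf.eq_smul_of_add_eq (hGc z) (hGp z hz) (hGc (-z)) (hGp (-z) (by simpa using hz)) ?_
    funext x
    simp only [G, Pi.add_apply, star_neg]
    ring
  -- The values z = 1 and z = i control F + F' and F - F' respectively, which isolates F.
  obtain ⟨a, ha⟩ := hG 1 (by simp)
  obtain ⟨b, hb⟩ := hG Complex.I (by simp)
  have hFf : ∀ x, F x = (2 * a - 1 - Complex.I * (2 * b - 1)) * f x := fun x => by
    have h1 := congrFun ha x
    have h2 := congrFun hb x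
    simp only [G, Pi.smul_apply, smul_eq_mul, Complex.star_def, Complex.conj_I,
      _root_.map_one]
      at h1 h2
    linear_combination 2 * h1 - 2 * Complex.I * h2 + (F x / 2 - F' x / 2) * Complex.I_mul_I
  have hFr : F r = f (r * s) :=
    tendsto_nhds_unique (hF r) (tendsto_const_nhds.congr fun n => (hrt n).symm)
  have hF1 : F 1 = f s :=
    tendsto_nhds_unique (hF 1) (tendsto_const_nhds.congr fun n => by rw [one_mul, ht])
  rw [← hFr, ← hF1, hFf r, hFf 1, hf.map_one]
  ring

end RInfty

theorem mainTheorem2 (f : RInfty → ℂ) (hf : RInfty.IsFiniteCharacter f)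
    (r : RInfty) (k : ℕ) (q : Fin k → RInfty)
    (hq : ∀ j, RInfty.IsQuasicycle (q j))
    (hdisj : ∀ i j, i ≠ j → Disjoint (q i).supp (q j).supp)
    (hr : r = (List.ofFn q).prod) :
    f r = ∏ j, f (q j) := by
  subst hr
  clear hq
  induction k with
  | zero => simpa using hf.map_one
  | succ k ih =>
    rw [List.ofFn_succ, List.prod_cons, Fin.prod_univ_succ, hf.map_mul_of_disjoint, ih]
    · exact fun i j hij => hdisj _ _ fun h => hij (Fin.succ_injective _ h)
    · refine Set.disjoint_left.2 fun n hn hn' => ?_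
      refine RInfty.supp_list_prod_subset (A := (q 0).suppᶜ) _ ?_ hn' hn
      intro x hx
      obtain ⟨i, rfl⟩ := (List.mem_ofFn' _ _).1 hx
      exact (hdisj _ _ (Fin.succ_ne_zero i)).subset_compl_right
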